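/- **Setting.** Let $d\ge 2$, let $n_1,\dots,n_d\ge 1$, put $N=\prod_{k=1}^d n_k$, and let $p_k=(p_{1,k},\dots,p_{n_k,k})^\top\in\mathbb R^{n_k}$, $k\in[d]$, be positive probability vectors. Let $\mathcal C\in\bigotimes_{k=1}^d\mathbb R^{n_k}$, with the inner product $\langle \mathcal C,\mathcal U\rangle=\sum c_{i_1,\dots,i_d}u_{i_1,\dots,i_d}$. Let $V(P)$ be the polytope of entrywise nonnegative tensors $\mathcal V\in\bigotimes_{k=1}^d\mathbb R^{n_k}$ such that for each $k\in[d]$ the marginal obtained by summing $\mathcal V$ over its $k$-th index equals $\bigotimes_{j\ne k}p_j$. Let $V_0$ be the linear space of real tensors all of whose marginals obtained by summing over one index are $0$. Let $$D=\Big(\bigotimes_{k=1}^d p_k+V_0\Big)\cap\{\mathcal X:\ \text{all entries of }\mathcal X\text{ are }>0\},\qquad \tilde\sigma(\mathcal X)=-\sum_{i_1,\dots,i_d}\log x_{i_1,\dots,i_d}\quad(\mathcal X\in D).$$ Put $\tau=\min_{\mathcal U\in V(P)}\langle \mathcal C,\mathcal U\rangle$ and $\tau_{\max}=\max_{\mathcal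 U\in V(P)}\langle \mathcal C,\mathcal U\rangle$. All derivatives of functions on $D$ are taken along $V_0$. For $x\in D$, $u\in V_0$ and a linear functional $\ell$ on $V_0$ put $\|u\|_x=(D^2\tilde\sigma(x)[u,u])^{1/2}$ and $\|\ell\|_x^*=\|D^2\tilde\sigma(x)^{-1}\ell\|_x$. The Newton step of $g$ at $x$ is $-D^2g(x)^{-1}Dg(x)\in V_0$. The complexity value $\theta(\tilde\sigma)$ is the supremum over $x\in D$ of the least $\lambda^2\in[0,\infty]$ with $|D\tilde\sigma(x)[u]|^2\le\lambda^2D^2\tilde\sigma(x)[u,u]$ for all $u\in V_0$. **Short-step interior point method** with barrier $\tilde\sigma$, starting at $x_0=\bigotimes_k p_k$, with step parameter $\vartheta\ge 0$. Each iteration takes one Newton step. * *Centering phase.* Start with $x=x_0$, $\nu=1$. While the Newton step of $\tilde\sigma$ at $x$ has $\|\cdot\|_x$-norm greater than $\frac16$, replace $\nu$ by $(1-\frac1{8\sqrt{\vartheta}})\nu$ and add to $x$ the Newton step of $\tilde\sigma-\nu D\tilde\sigma(x_0)$ at $x$. * *Switch.* When that norm is at most $\frac16$, set $\eta=1/(12\|\mathcal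 C\|_x^*)$ (with $\eta=0$ if $\mathcal C$ vanishes on $V_0$) and add to $x$ the Newton step of $\eta\langle\mathcal C,\cdot\rangle+\tilde\sigma$ at $x$. * *Path-following phase.* From then on, in every iteration replace $\eta$ by $(1+\frac1{8\sqrt{\vartheta}})\eta$ and add to $x$ the Newton step of $\eta\langle\mathcal C,\cdot\rangle+\tilde\sigma$ at $x$. (If $\vartheta=0$, which the theorem allows only when $V_0=\{0\}$ and all iterates are equal, read $\frac1{8\sqrt\vartheta}$ as $0$.) **Theorem.** There is an absolute constant $K>0$ such that, for all $d$, $n_k$, $p_k$, $\mathcal C$ as above, the minimum $\tau$ and the maximum $\tau_{\max}$ are attained, $\theta(\tilde\sigma)\le N$, and for every $\vartheta$ with $\theta(\tilde\sigma)\le\vartheta\le N$ the iterates $\mathcal X_0=\bigotimes_k p_k,\mathcal X_1,\mathcal X_2,\dots$ of the method all lie in $D$, the set of positive tensors of $V(P)$, and the method finds $\tau$ within precision $\varepsilon$, relative to the range of the objective, in $$O\Big(\sqrt{\prod_{k=1}^d n_k}\;\log\frac{\sqrt2\,\prod_{k=1}^d n_k}{\varepsilon\prod_{k=1}^d\min_{i\in[n_k]}p_{i,k}}\Big)$$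 iterations. That is, for every $\varepsilon>0$ and every integer $$m\ \ge\ K\sqrt{\prod_{k=1}^d n_k}\;\log\frac{\sqrt2\,\prod_{k=1}^d n_k}{\varepsilon\prod_{k=1}^d\min_{i\in[n_k]}p_{i,k}},\qquad m\ge 0,$$ one has $$0\le\langle\mathcal C,\mathcal X_m\rangle-\tau\le\varepsilon\,(\tau_{\max}-\tau).$$ In particular, the precision is $\varepsilon$ in the absolute sense whenever $\tau_{\max}-\tau\le 1$. -/

import Mathlib

open scoped NNReal ENNReal

noncomputable section

namespace TOT

/-! ### Newton steps, local norms and the complexity value of a barrier -/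

section Barrier

variable {E : Type*} [NormedAddCommGroup E] [NormedSpace ℝ E]

/-- The Hessian of `f` at `x`, as a linear map from the space to its dual. -/
def hessian (f : E → ℝ) (x : E) : E →L[ℝ] E →L[ℝ] ℝ :=
  fderiv ℝ (fderiv ℝ f) x

/-- The local norm `‖u‖_x = (D²f(x)[u,u])^{1/2}`. -/
def localNorm (f : E → ℝ) (x u : E) : ℝ :=
  Real.sqrt (hessian f x u u)

/-- The representative `D²f(x)⁻¹ ℓ` of a linear functional `ℓ` in the local inner product
at `x` (the Hessian is invertible in every use). -/
def localRep (f : E → ℝ) (x : E) (l : E →L[ℝ] ℝ) : E :=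
  (hessian f x).inverse l

/-- The Newton step `-D²f(x)⁻¹ Df(x)` of `f` at `x`. -/
def newtonStep (f : E → ℝ) (x : E) : E :=
  -localRep f x (fderiv ℝ f x)

/-- The complexity value of a standard self-concordant function `f` on `D`: the supremum over
`x ∈ D` of the least `t = λ²` such that `|Df(x)[u]|² ≤ λ² D²f(x)[u,u]` for all `u`
(`∞` if there is none). -/
def complexityValue (f : E → ℝ) (D : Set E) : ℝ≥0∞ :=
  ⨆ x ∈ D, ⨅ (t : ℝ≥0) (_ : ∀ u : E, (fderiv ℝ f x u) ^ 2 ≤ t * hessian f x u u), (t : ℝ≥0∞)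

/-! ### The short-step path-following method -/

/-- The state of the method: the current point together with the path parameter, in one of
the two phases.
* `centering x ν`: `x` is close to the minimizer of `f - ν Df(x₀)`, where `x₀` is the starting
  point, and `ν` is being decreased;
* `following x η`: `x` is close to the point `z(η)` of the central path, the minimizer of
  `η c + f`, and `η` is being increased. -/
inductive IPMState (E : Type*) where
  | centering (x : E) (ν : ℝ) : IPMState E
  | following (x : E) (η : ℝ) : IPMState E

/-- The current point. -/
def IPMState.point {E : Type*} : IPMState E → E
  | .centering x _ => x
  | .following x _ => x

open Classical in
/-- One iteration (one Newton step) of the short-step method with barrier `f`, objective `c`,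
starting point `x₀` and step parameter `θ`.

In the centering phase, as long as the Newton step of `f` at `x` has local norm more than `1/6`,
replace `ν` by `(1 - 1/(8√θ)) ν` and take a Newton step for `f - ν Df(x₀)`. Once the local norm
is at most `1/6`, set `η = 1/(12 ‖c_x‖_x)`, where `c_x = D²f(x)⁻¹ c`, take a Newton step for
`η c + f`, and start to follow the central path. In the following phase replace `η` by
`(1 + 1/(8√θ)) η` and take a Newton step for `η c + f`. -/
def ipmStep (f : E → ℝ) (c : E →L[ℝ] ℝ) (x₀ : E) (θ : ℝ) : IPMState E → IPMState E
  | .centering x ν =>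
      if localNorm f x (newtonStep f x) ≤ 1 / 6 then
        let η := 1 / (12 * localNorm f x (localRep f x c))
        .following (x + newtonStep (fun y => η * c y + f y) x) η
      else
        let ν' := (1 - 1 / (8 * Real.sqrt θ)) * ν
        .centering (x + newtonStep (fun y => f y - ν' * fderiv ℝ f x₀ y) x) ν'
  | .following x η =>
      let η' := (1 + 1 / (8 * Real.sqrt θ)) * η
      .following (x + newtonStep (fun y => η' * c y + f y) x) η'

/-- The point produced by `m` iterations of the short-step method started at `x₀`
(with `ν = 1`, for which `x₀` is exactly on the path of the centering phase). -/
def ipmIterate (f : E → ℝ) (c : E →L[ℝ] ℝ) (x₀ : E) (θ : ℝ) (m : ℕ) : E :=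
  ((ipmStep f c x₀ θ)^[m] (.centering x₀ 1)).point

end Barrier

/-! ### The polytope `V(P)` and its barrier -/

section Tensor

variable {d : ℕ}

/-- Real `n 0 × ⋯ × n (d-1)` tensors, with the Hilbert-Schmidt inner product. -/
abbrev Tensor (n : Fin d → ℕ) : Type :=
  EuclideanSpace ℝ ((k : Fin d) → Fin (n k))

variable {n : Fin d → ℕ}

/-- The contraction of `U` with the all-ones vector in mode `k`, i.e. the `(d-1)`-way marginal
obtained by summing out the `k`-th index. The `k`-th entry of the index `i` plays no role. -/
def modeSum (k : Fin d) (U : Tensor n) (i : (j : Fin d) → Fin (n j)) : ℝ :=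
  ∑ a : Fin (n k), U (Function.update i k a)

/-- The rank-one tensor `p₁ ⊗ ⋯ ⊗ p_d`. -/
def prodTensor (p : (k : Fin d) → Fin (n k) → ℝ) : Tensor n :=
  WithLp.toLp 2 fun i => ∏ k, p k (i k)

/-- The polytope `V(P)`: nonnegative tensors whose `(d-1)`-way marginal along each mode `k` is
the tensor product of the `p j` with `j ≠ k`. -/
def polytopeV (p : (k : Fin d) → Fin (n k) → ℝ) : Set (Tensor n) :=
  {U | (∀ i, 0 ≤ U i) ∧ ∀ k i, modeSum k U i = ∏ j ∈ Finset.univ.erase k, p j (i j)}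

/-- The relative interior of `V(P)`: its entrywise positive elements. -/
def interiorV (p : (k : Fin d) → Fin (n k) → ℝ) : Set (Tensor n) :=
  {U | U ∈ polytopeV p ∧ ∀ i, 0 < U i}

variable (n) in
/-- The direction space of `V(P)`: tensors all of whose `(d-1)`-way marginals vanish. -/
def spaceV0 : Submodule ℝ (Tensor n) where
  carrier := {U | ∀ k i, modeSum k U i = 0}
  add_mem' := by
    intro U W hU hW k i
    have h1 := hU k i
    have h2 := hW k i
    simp only [modeSum] at h1 h2 ⊢
    simp [Finset.sum_add_distrib, h1, h2]
  zero_mem' := by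
    intro k i
    simp [modeSum]
  smul_mem' := by
    intro r U hU k i
    have h1 := hU k i
    simp only [modeSum] at h1 ⊢
    simp [← Finset.mul_sum, h1]

/-- The logarithmic barrier `σ(X) = -∑ log x_i` of the positive orthant. -/
def sigma (X : Tensor n) : ℝ :=
  -∑ i, Real.log (X i)

/-- The restriction of `σ` to the affine space `⊗ p_k + V₀`, parametrized by
`W ∈ V₀ ↦ ⊗ p_k + W`. -/
def sigmaTilde (p : (k : Fin d) → Fin (n k) → ℝ) (W : spaceV0 n) : ℝ :=
  sigma (prodTensor p + (W : Tensor n))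

/-- The domain of the restricted barrier, in the same parametrization. -/
def domainV (p : (k : Fin d) → Fin (n k) → ℝ) : Set (spaceV0 n) :=
  {W | ∀ i, 0 < (prodTensor p + (W : Tensor n)) i}

/-- The linear functional `W ↦ ⟨C, W⟩` on `V₀`. -/
def costV (C : Tensor n) : spaceV0 n →L[ℝ] ℝ :=
  (innerSL ℝ C).comp (spaceV0 n).subtypeL

/-- The values `⟨C, U⟩`, `U ∈ V(P)`. -/
def costValues (C : Tensor n) (p : (k : Fin d) → Fin (n k) → ℝ) : Set ℝ :=
  (fun U : Tensor n => inner ℝ C U) '' polytopeV p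

/-- The minimum `τ(C,P)` of `⟨C, U⟩` over `V(P)`. -/
def tau (C : Tensor n) (p : (k : Fin d) → Fin (n k) → ℝ) : ℝ :=
  sInf (costValues C p)

/-- The maximum of `⟨C, U⟩` over `V(P)`. -/
def tauMax (C : Tensor n) (p : (k : Fin d) → Fin (n k) → ℝ) : ℝ :=
  sSup (costValues C p)

/-- The tensor produced by `m` iterations of the short-step method with the barrier `σ̃`
started at `⊗ p_k`. -/
def ipmTensor (C : Tensor n) (p : (k : Fin d) → Fin (n k) → ℝ) (θ : ℝ) (m : ℕ) : Tensor n :=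
  prodTensor p + ((ipmIterate (sigmaTilde p) (costV C) 0 θ m : spaceV0 n) : Tensor n)

end Tensor

end TOT

end

noncomputable section

namespace TOT

open Filter Topology

/-! ### Derivatives of sums of logarithms of affine functions. -/

section AffineLog

variable {ι E : Type*} [Fintype ι] [NormedAddCommGroup E] [NormedSpace ℝ E]

/-! The local norm of the logarithmic barrier is the Euclidean norm of the relative displacements `u
i / (b + x) i`. This makes the Newton analysis explicit, with no general self-concordance theory: if
the gradient residual has dual local norm `δ < 1`, a Newton step stays in the positive orthant and
leaves a residual of at most `δ ^ 2` (`Centered.newtonStep`).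

Put `β = 1 / (8√θ)`, with `θ` the step parameter. All iterates keep a residual of at most 1/9:
changing the path parameter by the factor `1 ± β` raises it to at most 1/4, since the barrier
gradient has dual norm at most `√θ`, and the Newton step brings it down to 1/16
(`IPMInvariant.step`). This needs `θ ≥ 1`, which is proved by approaching the boundary along a line
(`one_le_of_complexityValue_le`).

Let `N` be the number of entries, `a` the product of the minima of the `p k`, and `R` the range of
the objective. Centering ends once `ν` times the dual norm of the initial gradient, at most `N / a`,
is below 1/18. The local unit ball lies in the closed polytope, so the cost has dual norm at most `R
/ 2`, and path-following starts with `η ≥ 1 / (6R)`. A point with residual at most 1/9 has gap at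
most `(10/9) N / η` (`Centered.mul_sub_le`), and `η` grows geometrically. Both phases thus take
`O(√N)` times a logarithm (`exists_phase_lengths`). -/

theorem hasFDerivAt_neg_sum_log (a : ι → ℝ) (φ : ι → E →L[ℝ] ℝ) {x : E}
    (hx : ∀ i, 0 < a i + φ i x) :
    HasFDerivAt (fun y => -∑ i, Real.log (a i + φ i y)) (-∑ i, (a i + φ i x)⁻¹ • φ i) x := by
  refine (HasFDerivAt.fun_sum fun i _ => ?_).neg
  exact ((φ i).hasFDerivAt.const_add _).log (hx i).ne'

theorem hasFDerivAt_neg_sum_inv_smul (a : ι → ℝ) (φ : ι → E →L[ℝ] ℝ) {x : E}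
    (hx : ∀ i, 0 < a i + φ i x) :
    HasFDerivAt (fun y => -∑ i, (a i + φ i y)⁻¹ • φ i)
      (-∑ i, ((-((a i + φ i x) ^ 2)⁻¹) • φ i).smulRight (φ i)) x := by
  refine (HasFDerivAt.fun_sum fun i _ => ?_).neg
  have h : HasFDerivAt (fun y => (a i + φ i y)⁻¹) ((-((a i + φ i x) ^ 2)⁻¹) • φ i) x :=
    (hasDerivAt_inv (hx i).ne').comp_hasFDerivAt x ((φ i).hasFDerivAt.const_add (a i))
  exact HasFDerivAt.smul_const h (φ i)

/-- A linear term only shifts the gradient by a constant, so every function the method minimizes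
shares the Hessian of the barrier. -/
theorem hessian_add_of_hasFDerivAt {f : E → ℝ} {g : E → E →L[ℝ] ℝ} {H : E →L[ℝ] E →L[ℝ] ℝ} {x : E}
    (l : E →L[ℝ] ℝ) (hf : ∀ᶠ y in 𝓝 x, HasFDerivAt f (g y) y) (hg : HasFDerivAt g H x) :
    hessian (fun y => l y + f y) x = H := by
  have h : fderiv ℝ (fun y => l y + f y) =ᶠ[𝓝 x] fun y => l + g y := by
    filter_upwards [hf] with y hy
    exact (l.hasFDerivAt.add hy).fderiv
  rw [hessian, h.fderiv_eq]
  exact (HasFDerivAt.const_add l hg).fderiv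

end AffineLog

/-! ### Local geometry of the logarithmic barrier and its Newton step. -/

section LogBarrier

variable {ι : Type*}

/-- The `i`-th coordinate functional on `V`. -/
def coordV (V : Submodule ℝ (EuclideanSpace ℝ ι)) (i : ι) : V →L[ℝ] ℝ :=
  (EuclideanSpace.proj i : EuclideanSpace ℝ ι →L[ℝ] ℝ).comp V.subtypeL

@[simp] theorem coordV_apply {V : Submodule ℝ (EuclideanSpace ℝ ι)} (i : ι) (u : V) :
    coordV V i u = (u : EuclideanSpace ℝ ι) i := rfl

variable [Fintype ι]

/-- The logarithmic barrier of the positive orthant, restricted to `b + V`. -/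
def logBarrier (V : Submodule ℝ (EuclideanSpace ℝ ι)) (b : EuclideanSpace ℝ ι) (W : V) : ℝ :=
  -∑ i, Real.log ((b + (W : EuclideanSpace ℝ ι)) i)

/-- The part of `b + V` in the open positive orthant. -/
def posDomain (V : Submodule ℝ (EuclideanSpace ℝ ι)) (b : EuclideanSpace ℝ ι) : Set V :=
  {W | ∀ i, 0 < (b + (W : EuclideanSpace ℝ ι)) i}

variable {V : Submodule ℝ (EuclideanSpace ℝ ι)} {b : EuclideanSpace ℝ ι}

/-- The quotient `u i / (b + x) i`. -/
def relCoord (b : EuclideanSpace ℝ ι) (x u : V) (i : ι) : ℝ :=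
  (u : EuclideanSpace ℝ ι) i / (b + (x : EuclideanSpace ℝ ι)) i

/-- The local norm of the logarithmic barrier. -/
def relNorm (b : EuclideanSpace ℝ ι) (x u : V) : ℝ :=
  Real.sqrt (∑ i, relCoord b x u i ^ 2)

theorem isOpen_posDomain : IsOpen (posDomain V b) := by
  have : posDomain V b = ⋂ i, {W : V | 0 < (b + (W : EuclideanSpace ℝ ι)) i} := by
    ext W; simp [posDomain]
  rw [this]
  refine isOpen_iInter_of_finite fun i => isOpen_lt continuous_const ?_
  have : (fun W : V => (b + (W : EuclideanSpace ℝ ι)) i) = fun W => b i + coordV V i W := by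
    ext W; simp
  rw [this]; fun_prop

/-- The derivative of the logarithmic barrier. -/
def gradForm (b : EuclideanSpace ℝ ι) (x : V) : V →L[ℝ] ℝ :=
  -∑ i, ((b + (x : EuclideanSpace ℝ ι)) i)⁻¹ • coordV V i

/-- The second derivative of the logarithmic barrier. -/
def hessForm (b : EuclideanSpace ℝ ι) (x : V) : V →L[ℝ] V →L[ℝ] ℝ :=
  -∑ i, ((-(((b + (x : EuclideanSpace ℝ ι)) i) ^ 2)⁻¹) • coordV V i).smulRight (coordV V i)

theorem gradForm_apply (x u : V) : gradForm b x u = -∑ i, relCoord b x u i := by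
  simp [gradForm, relCoord, div_eq_inv_mul]

theorem hessForm_apply (x u v : V) :
    hessForm b x u v = ∑ i, relCoord b x u i * relCoord b x v i := by
  simp only [hessForm, relCoord, neg_apply, sum_apply,
    ContinuousLinearMap.smulRight_apply, smul_apply, coordV_apply, smul_eq_mul]
  rw [← Finset.sum_neg_distrib]
  refine Finset.sum_congr rfl fun i _ => ?_
  rw [div_mul_div_comm, div_eq_mul_inv, sq]; ring

theorem hasFDerivAt_logBarrier {x : V} (hx : x ∈ posDomain V b) :
    HasFDerivAt (logBarrier V b) (gradForm b x) x :=
  hasFDerivAt_neg_sum_log (fun i => b i) (coordV V) hx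

theorem hasFDerivAt_gradForm {x : V} (hx : x ∈ posDomain V b) :
    HasFDerivAt (gradForm b : V → V →L[ℝ] ℝ) (hessForm b x) x :=
  hasFDerivAt_neg_sum_inv_smul (fun i => b i) (coordV V) hx

theorem hasFDerivAt_add_logBarrier (l : V →L[ℝ] ℝ) {x : V} (hx : x ∈ posDomain V b) :
    HasFDerivAt (fun y => l y + logBarrier V b y) (l + gradForm b x) x :=
  l.hasFDerivAt.add (hasFDerivAt_logBarrier hx)

theorem hessian_add_logBarrier (l : V →L[ℝ] ℝ) {x : V} (hx : x ∈ posDomain V b) :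
    hessian (fun y => l y + logBarrier V b y) x = hessForm b x := by
  refine hessian_add_of_hasFDerivAt l ?_ (hasFDerivAt_gradForm hx)
  filter_upwards [isOpen_posDomain.mem_nhds hx] with y hy using hasFDerivAt_logBarrier hy

theorem hessian_logBarrier {x : V} (hx : x ∈ posDomain V b) :
    hessian (logBarrier V b) x = hessForm b x := by
  simpa using hessian_add_logBarrier (0 : V →L[ℝ] ℝ) hx

theorem localNorm_logBarrier {x : V} (hx : x ∈ posDomain V b) (u : V) :
    localNorm (logBarrier V b) x u = relNorm b x u := by
  simp only [localNorm, relNorm, hessian_logBarrier hx, hessForm_apply, sq]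

theorem relNorm_nonneg (x u : V) : 0 ≤ relNorm b x u := Real.sqrt_nonneg _

theorem relNorm_sq (x u : V) : relNorm b x u ^ 2 = ∑ i, relCoord b x u i ^ 2 :=
  Real.sq_sqrt (Finset.sum_nonneg fun _ _ => sq_nonneg _)

theorem abs_relCoord_le (x u : V) (i : ι) : |relCoord b x u i| ≤ relNorm b x u := by
  refine Real.abs_le_sqrt ?_
  exact Finset.single_le_sum (f := fun i => relCoord b x u i ^ 2) (fun _ _ => sq_nonneg _)
    (Finset.mem_univ i)

theorem abs_coord_le {x : V} (hx : x ∈ posDomain V b) (u : V) (i : ι) :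
    |(u : EuclideanSpace ℝ ι) i| ≤ relNorm b x u * (b + (x : EuclideanSpace ℝ ι)) i := by
  have := abs_relCoord_le (b := b) x u i
  rwa [relCoord, abs_div, abs_of_pos (hx i), div_le_iff₀ (hx i)] at this

theorem eq_zero_of_relNorm_eq_zero {x : V} (hx : x ∈ posDomain V b) {u : V}
    (hu : relNorm b x u = 0) : u = 0 := by
  ext i
  have := abs_coord_le hx u i
  rw [hu, zero_mul] at this
  simpa using abs_nonpos_iff.1 this

theorem abs_hessForm_le (x u v : V) :
    |hessForm b x u v| ≤ relNorm b x u * relNorm b x v := by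
  rw [hessForm_apply, relNorm, relNorm, ← Real.sqrt_mul (Finset.sum_nonneg fun _ _ => sq_nonneg _)]
  exact Real.abs_le_sqrt (Finset.sum_mul_sq_le_sq_mul_sq _ _ _)

/-- Positive definiteness gives injectivity, and `V` and its dual have the same finite dimension.
This excludes the default value 0 of `ContinuousLinearMap.inverse`, so `localRep` is the true
representative. -/
theorem isInvertible_hessForm {x : V} (hx : x ∈ posDomain V b) :
    (hessForm b x).IsInvertible := by
  have hinj : Function.Injective (hessForm b x).toLinearMap := by
    rw [← LinearMap.ker_eq_bot, LinearMap.ker_eq_bot']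
    intro u hu
    refine eq_zero_of_relNorm_eq_zero hx ?_
    have h : hessForm b x u u = 0 := by
      have : hessForm b x u = 0 := hu
      simp [this]
    rw [← sq_eq_zero_iff, relNorm_sq, ← h, hessForm_apply]
    simp [sq]
  have hfin : Module.finrank ℝ V = Module.finrank ℝ (V →L[ℝ] ℝ) := by
    rw [← (LinearMap.toContinuousLinearMap (𝕜 := ℝ) (E := V) (F' := ℝ)).finrank_eq]
    exact (Subspace.dual_finrank_eq (K := ℝ) (V := V)).symm
  refine ⟨(LinearEquiv.ofInjectiveOfFinrankEq _ hinj hfin).toContinuousLinearEquiv, ?_⟩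
  ext u v
  rfl

theorem hessForm_localRep {x : V} (hx : x ∈ posDomain V b) (m l : V →L[ℝ] ℝ) :
    hessForm b x (localRep (fun y => m y + logBarrier V b y) x l) = l := by
  rw [localRep, hessian_add_logBarrier m hx]
  obtain ⟨e, he⟩ := isInvertible_hessForm hx
  rw [← he, ContinuousLinearMap.inverse_equiv]
  simp

theorem hessForm_newtonStep {x : V} (hx : x ∈ posDomain V b) (l : V →L[ℝ] ℝ) :
    hessForm b x (newtonStep (fun y => l y + logBarrier V b y) x) = -(l + gradForm b x) := by
  rw [newtonStep, map_neg, hessForm_localRep hx, (hasFDerivAt_add_logBarrier l hx).fderiv]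

/-- Testing the bound at `v = u`, where `l u` is the squared local norm of `u`, leaves one factor to
cancel. This turns dual bounds into bounds on representatives. -/
theorem relNorm_le_of_hessForm_eq {x : V} {l : V →L[ℝ] ℝ} {u : V} (hu : hessForm b x u = l)
    {B : ℝ} (hB : 0 ≤ B) (h : ∀ v, |l v| ≤ B * relNorm b x v) : relNorm b x u ≤ B := by
  have h1 : relNorm b x u ^ 2 = l u := by
    rw [relNorm_sq, ← hu, hessForm_apply]; simp [sq]
  have h2 := (le_abs_self _).trans (h u)
  rw [← h1, sq] at h2
  rcases (relNorm_nonneg (b := b) x u).eq_or_lt with h0 | h0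
  · rw [← h0]; exact hB
  · exact le_of_mul_le_mul_right h2 h0

/-- The functional `l + Df(x)`, where `f` is the logarithmic barrier, has dual local norm at
most `δ`. -/
def Centered (b : EuclideanSpace ℝ ι) (l : V →L[ℝ] ℝ) (x : V) (δ : ℝ) : Prop :=
  ∀ v, |l v + gradForm b x v| ≤ δ * relNorm b x v

theorem Centered.mono {l : V →L[ℝ] ℝ} {x : V} {δ δ' : ℝ} (h : Centered b l x δ) (hδ : δ ≤ δ') :
    Centered b l x δ' := fun v =>
  (h v).trans (mul_le_mul_of_nonneg_right hδ (relNorm_nonneg _ _))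

theorem Centered.relNorm_newtonStep_le {l : V →L[ℝ] ℝ} {x : V} {δ : ℝ} (h : Centered b l x δ)
    (hx : x ∈ posDomain V b) (hδ : 0 ≤ δ) :
    relNorm b x (newtonStep (fun y => l y + logBarrier V b y) x) ≤ δ := by
  refine relNorm_le_of_hessForm_eq (hessForm_newtonStep hx l) hδ fun v => ?_
  simpa only [neg_apply, abs_neg, add_apply] using h v

theorem centered_of_relNorm_newtonStep_le {l : V →L[ℝ] ℝ} {x : V} {δ : ℝ}
    (hx : x ∈ posDomain V b)
    (h : relNorm b x (newtonStep (fun y => l y + logBarrier V b y) x) ≤ δ) :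
    Centered b l x δ := by
  intro v
  have h1 := abs_hessForm_le (b := b) x (newtonStep (fun y => l y + logBarrier V b y) x) v
  rw [hessForm_newtonStep hx, neg_apply, abs_neg] at h1
  exact h1.trans (mul_le_mul_of_nonneg_right h (relNorm_nonneg _ _))

/-- The step multiplies each coordinate by `1 + r i`, where `r` is the relative displacement and `|r
i| ≤ δ < 1`, so positivity survives. The first-order part of the new residual cancels by the Newton
equation; what remains is quadratic in `r`. -/
theorem Centered.newtonStep {l : V →L[ℝ] ℝ} {x : V} {δ : ℝ} (h : Centered b l x δ)
    (hx : x ∈ posDomain V b) (hδ : 0 ≤ δ) (hδ1 : δ < 1) :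
    x + newtonStep (fun y => l y + logBarrier V b y) x ∈ posDomain V b ∧
      Centered b l (x + TOT.newtonStep (fun y => l y + logBarrier V b y) x) (δ ^ 2) := by
  have hn := h.relNorm_newtonStep_le hx hδ
  have hs := hessForm_newtonStep hx l
  set u := TOT.newtonStep (fun y => l y + logBarrier V b y) x
  have hfac : ∀ i, (b + ((x + u : V) : EuclideanSpace ℝ ι)) i =
      (b + (x : EuclideanSpace ℝ ι)) i * (1 + relCoord b x u i) := by
    intro i
    have := (hx i).ne'
    rw [relCoord, mul_add, mul_div_cancel₀ _ this]
    simp [add_assoc]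
  have hone : ∀ i, 0 < 1 + relCoord b x u i := by
    intro i
    have := (abs_le.1 ((abs_relCoord_le (b := b) x u i).trans hn)).1
    linarith
  have hmem : x + u ∈ posDomain V b := fun i => by
    rw [hfac]; exact mul_pos (hx i) (hone i)
  refine ⟨hmem, fun v => ?_⟩
  -- With `w` the relative coordinates of `v` at the new point, those at `x` are `(1 + r i) * w i`,
  -- and `(1 - r i) * (1 + r i) * w i - w i = -r i ^ 2 * w i`.
  have hv : l v + gradForm b (x + u) v =
      -∑ i, relCoord b x u i ^ 2 * relCoord b (x + u) v i := by
    have h1 : l v = -(hessForm b x u v) - gradForm b x v := by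
      rw [hs]; simp
    rw [h1, hessForm_apply, gradForm_apply, gradForm_apply, sub_neg_eq_add,
      ← Finset.sum_neg_distrib, ← Finset.sum_neg_distrib, ← Finset.sum_neg_distrib,
      ← Finset.sum_add_distrib, ← Finset.sum_add_distrib]
    refine Finset.sum_congr rfl fun i _ => ?_
    have h2 : relCoord b x v i = (1 + relCoord b x u i) * relCoord b (x + u) v i := by
      have := (hx i).ne'
      have := (hone i).ne'
      have h3 : relCoord b (x + u) v i = (v : EuclideanSpace ℝ ι) i /
          ((b + (x : EuclideanSpace ℝ ι)) i * (1 + relCoord b x u i)) := by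
        rw [← hfac]; rfl
      rw [h3, relCoord.eq_def b x v]
      field_simp
    rw [h2]; ring
  rw [hv, abs_neg]
  have hcs := Real.abs_le_sqrt (Finset.sum_mul_sq_le_sq_mul_sq Finset.univ
    (fun i => relCoord b x u i ^ 2) (relCoord b (x + u) v))
  refine hcs.trans ?_
  rw [Real.sqrt_mul (Finset.sum_nonneg fun _ _ => sq_nonneg _)]
  refine mul_le_mul_of_nonneg_right ?_ (Real.sqrt_nonneg _)
  rw [Real.sqrt_le_left (sq_nonneg _)]
  calc ∑ i, (relCoord b x u i ^ 2) ^ 2 ≤ ∑ i, δ ^ 2 * relCoord b x u i ^ 2 := by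
        refine Finset.sum_le_sum fun i _ => ?_
        rw [sq (relCoord b x u i ^ 2)]
        refine mul_le_mul_of_nonneg_right ?_ (sq_nonneg _)
        exact sq_le_sq' (by linarith [(abs_le.1 ((abs_relCoord_le (b := b) x u i).trans hn)).1])
          (abs_le.1 ((abs_relCoord_le (b := b) x u i).trans hn)).2
    _ = δ ^ 2 * relNorm b x u ^ 2 := by rw [← Finset.mul_sum, relNorm_sq]
    _ ≤ δ ^ 2 * δ ^ 2 := by
        have := relNorm_nonneg (b := b) x u
        gcongr
    _ = (δ ^ 2) ^ 2 := by ring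

end LogBarrier

/-! ### Complexity value, duality gap and dual norm bounds. -/

section LogBarrier

variable {ι : Type*} [Fintype ι] {V : Submodule ℝ (EuclideanSpace ℝ ι)} {b : EuclideanSpace ℝ ι}

theorem complexityValue_logBarrier_le :
    complexityValue (logBarrier V b) (posDomain V b) ≤ (Fintype.card ι : ℝ≥0∞) := by
  refine iSup₂_le fun x hx => iInf₂_le_of_le (Fintype.card ι : ℝ≥0) (fun u => ?_) (by simp)
  rw [(hasFDerivAt_logBarrier hx).fderiv, hessian_logBarrier hx, hessForm_apply, gradForm_apply,
    neg_sq]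
  have := sq_sum_le_card_mul_sum_sq (s := Finset.univ) (f := relCoord b x u)
  simpa [sq] using this

theorem sq_gradForm_le {θ : ℝ≥0}
    (hθ : complexityValue (logBarrier V b) (posDomain V b) ≤ θ) {x : V} (hx : x ∈ posDomain V b)
    (v : V) : gradForm b x v ^ 2 ≤ θ * relNorm b x v ^ 2 := by
  have h1 := (le_iSup₂ (f := fun x (_ : x ∈ posDomain V b) => ⨅ (t : ℝ≥0)
    (_ : ∀ u : V, (fderiv ℝ (logBarrier V b) x u) ^ 2 ≤ t * hessian (logBarrier V b) x u u),
    (t : ℝ≥0∞)) x hx).trans hθ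
  refine le_of_forall_pos_le_add fun e he => ?_
  set H := relNorm b x v ^ 2
  have hH : 0 ≤ H := sq_nonneg _
  -- The infimum need not be known to be attained, so an admissible `t` is taken slightly above `θ`;
  -- the slack `e / (H + 1)` costs at most `e` after multiplication by `H`.
  have h2 := h1.trans_lt (ENNReal.coe_lt_coe.2 (lt_add_of_pos_right θ
    (show 0 < (⟨e / (H + 1), by positivity⟩ : ℝ≥0) from NNReal.coe_pos.1 (by
      change 0 < e / (H + 1); positivity))))
  simp only [iInf_lt_iff] at h2
  obtain ⟨t, ht, htθ⟩ := h2
  have h3 := ht v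
  rw [(hasFDerivAt_logBarrier hx).fderiv, hessian_logBarrier hx, hessForm_apply] at h3
  have h4 : (t : ℝ) ≤ θ + e / (H + 1) := by
    have := (ENNReal.coe_lt_coe.1 htθ).le
    exact_mod_cast this
  have h5 : ∑ i, relCoord b x v i * relCoord b x v i = H := by
    simp only [H, relNorm_sq]
    simp only [sq]
  rw [h5] at h3
  refine h3.trans ((mul_le_mul_of_nonneg_right h4 hH).trans ?_)
  rw [add_mul]
  have : e / (H + 1) * H ≤ e := by
    rw [div_mul_eq_mul_div, div_le_iff₀ (by positivity)]
    nlinarith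
  linarith

theorem abs_gradForm_le {θ : ℝ≥0}
    (hθ : complexityValue (logBarrier V b) (posDomain V b) ≤ θ) {x : V} (hx : x ∈ posDomain V b)
    (v : V) : |gradForm b x v| ≤ Real.sqrt θ * relNorm b x v := by
  have := Real.abs_le_sqrt (sq_gradForm_le hθ hx v)
  rwa [Real.sqrt_mul (by positivity), Real.sqrt_sq (relNorm_nonneg _ _)] at this

/-- The complexity value is at least `1` as soon as some line in the domain reaches the
boundary of the orthant. -/
theorem one_le_of_complexityValue_le {θ : ℝ≥0}
    (hθ : complexityValue (logBarrier V b) (posDomain V b) ≤ θ) (hb : ∀ i, 0 < b i) {u : V}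
    (hu : ∃ i, (u : EuclideanSpace ℝ ι) i < 0) : (1 : ℝ) ≤ θ := by
  classical
  obtain ⟨i₁, hi₁⟩ := hu
  set a : ι → ℝ := fun i => (u : EuclideanSpace ℝ ι) i with ha
  -- Ratio test: `i₀` is a coordinate that first vanishes along the ray `b + t u`, and `T` is the
  -- time when it does.
  obtain ⟨i₀, hi₀, hmin⟩ := Finset.exists_min_image (Finset.univ.filter fun i => a i < 0)
    (fun i => b i / (-a i)) ⟨i₁, by simpa [ha] using hi₁⟩
  have hi₀ : a i₀ < 0 := (Finset.mem_filter.1 hi₀).2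
  set T := b i₀ / (-a i₀) with hT
  have hTpos : 0 < T := div_pos (hb _) (by linarith)
  set w : ι → ℝ := fun i => b i + T * a i with hw
  have hwneg : ∀ i, a i < 0 → 0 ≤ w i := fun i hi => by
    have h := hmin i (by simpa using hi)
    have : T * (-a i) ≤ b i := by
      rwa [le_div_iff₀ (by linarith)] at h
    simp only [hw]; linarith
  have hwpos : ∀ i, 0 ≤ a i → 0 < w i := fun i hi => by
    have := hb i
    have := mul_nonneg hTpos.le hi
    simp only [hw]; linarith
  have hw₀ : w i₀ = 0 := by
    have : T * (-a i₀) = b i₀ := div_mul_cancel₀ _ (by linarith)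
    simp only [hw]; linarith
  have hdom : ∀ s, 0 < s → s < T → (T - s) • u ∈ posDomain V b := by
    intro s hs hsT i
    have h1 : (b + (((T - s) • u : V) : EuclideanSpace ℝ ι)) i = w i - s * a i := by
      simp only [hw, ha, PiLp.add_apply, Submodule.coe_smul, PiLp.smul_apply, smul_eq_mul]; ring
    rw [h1]
    rcases lt_or_ge (a i) 0 with h | h
    · have := hwneg i h
      nlinarith
    · have h2 : w i - s * a i = b i + (T - s) * a i := by simp only [hw]; ring
      have := hb i
      have := mul_nonneg (sub_pos.2 hsT).le h
      linarith
  have hineq : ∀ s, 0 < s → s < T → (∑ i, s * a i / (w i - s * a i)) ^ 2 ≤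
      θ * ∑ i, (s * a i / (w i - s * a i)) ^ 2 := by
    intro s hs hsT
    have h := sq_gradForm_le hθ (hdom s hs hsT) (s • u)
    have h1 : ∀ i, relCoord b ((T - s) • u) (s • u) i = s * a i / (w i - s * a i) := by
      intro i
      simp only [relCoord, hw, ha, PiLp.add_apply, Submodule.coe_smul, PiLp.smul_apply,
        smul_eq_mul]
      congr 1; ring
    rw [gradForm_apply, neg_sq, relNorm_sq] at h
    simpa only [h1] using h
  -- At distance `s` from the exit point only the `k` vanishing coordinates contribute in the limit,
  -- each with -1. The inequality becomes `k ^ 2 ≤ θ * k` with `k ≥ 1`.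
  have hlim : ∀ i, Tendsto (fun s => s * a i / (w i - s * a i)) (𝓝[>] (0 : ℝ))
      (𝓝 (if w i = 0 then -1 else 0)) := by
    intro i
    split_ifs with h
    · have hai : a i ≠ 0 := fun h0 => (hwpos i h0.ge).ne' h
      refine tendsto_const_nhds.congr' ?_
      filter_upwards [self_mem_nhdsWithin] with s hs
      have hs : s ≠ 0 := ne_of_gt hs
      rw [h, zero_sub, div_neg, div_self (mul_ne_zero hs hai)]
    · have hc : ContinuousAt (fun s => s * a i / (w i - s * a i)) 0 := by
        refine ContinuousAt.div (by fun_prop) (by fun_prop) (by simpa using h)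
      have := hc.tendsto
      simp only [zero_mul, zero_div] at this
      exact this.mono_left nhdsWithin_le_nhds
  have hl1 := (tendsto_finsetSum Finset.univ fun i _ => hlim i).pow 2
  have hl2 := (tendsto_finsetSum Finset.univ fun i _ => (hlim i).pow 2).const_mul (θ : ℝ)
  have hle := le_of_tendsto_of_tendsto hl1 hl2 (by
    filter_upwards [Ioo_mem_nhdsGT hTpos] with s hs using hineq s hs.1 hs.2)
  set k := (Finset.univ.filter fun i => w i = 0).card with hk
  have hkpos : (1 : ℝ) ≤ k := by
    exact_mod_cast Finset.card_pos.2 ⟨i₀, by simpa using hw₀⟩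
  have e1 : ∑ i, (if w i = 0 then (-1 : ℝ) else 0) = -k := by
    rw [← Finset.sum_filter]; simp [hk]
  have e2 : ∑ i, (if w i = 0 then (-1 : ℝ) else 0) ^ 2 = k := by
    rw [hk, Finset.card_eq_sum_ones, Finset.sum_filter]; push_cast
    refine Finset.sum_congr rfl fun i _ => ?_
    split_ifs <;> simp
  rw [e1, e2, neg_sq, sq] at hle
  exact hkpos.trans (le_of_mul_le_mul_right hle (by linarith))

/-- Test the residual on `y - x`. With `r i` the ratio of the coordinates at `y` and `x`, each
coordinate contributes at most `(1 - r i) + δ * (1 + r i)`, which is at most `1 + δ` because `δ ≤ 1`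
and `r i ≥ 0`. -/
theorem Centered.mul_sub_le {c : V →L[ℝ] ℝ} {η : ℝ} {x : V} {δ : ℝ}
    (h : Centered b (η • c) x δ) (hx : x ∈ posDomain V b) (hδ : 0 ≤ δ) (hδ1 : δ ≤ 1) {y : V}
    (hy : ∀ i, 0 ≤ (b + (y : EuclideanSpace ℝ ι)) i) :
    η * (c x - c y) ≤ (1 + δ) * Fintype.card ι := by
  set r : ι → ℝ := fun i => (b + (y : EuclideanSpace ℝ ι)) i / (b + (x : EuclideanSpace ℝ ι)) i
  have hr : ∀ i, 0 ≤ r i := fun i => div_nonneg (hy i) (hx i).le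
  have hrel : ∀ i, relCoord b x (y - x) i = r i - 1 := fun i => by
    have := (hx i).ne'
    have h1 : ((y - x : V) : EuclideanSpace ℝ ι) i =
        (b + (y : EuclideanSpace ℝ ι)) i - (b + (x : EuclideanSpace ℝ ι)) i := by simp
    rw [relCoord, h1, sub_div, div_self this]
  have h1 := (abs_le.1 (h (y - x))).1
  have hnorm : relNorm b x (y - x) ≤ ∑ i, (r i + 1) := by
    have h2 : relNorm b x (y - x) ≤ ∑ i, |relCoord b x (y - x) i| := by
      rw [relNorm, Real.sqrt_le_left (Finset.sum_nonneg fun _ _ => abs_nonneg _)]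
      simp_rw [← sq_abs (relCoord b x (y - x) _)]
      exact Finset.sum_sq_le_sq_sum_of_nonneg fun _ _ => abs_nonneg _
    refine h2.trans (Finset.sum_le_sum fun i _ => ?_)
    rw [hrel, abs_le]
    constructor <;> linarith [hr i]
  have hgrad : gradForm b x (y - x) = ∑ i, (1 - r i) := by
    rw [gradForm_apply, ← Finset.sum_neg_distrib]
    refine Finset.sum_congr rfl fun i _ => ?_
    rw [hrel]; ring
  have h3 : (η • c) (y - x) = -(η * (c x - c y)) := by
    rw [smul_apply, map_sub, smul_eq_mul]; ring
  rw [h3, hgrad] at h1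
  have h4 := mul_le_mul_of_nonneg_left hnorm hδ
  have h5 : ∑ i, (1 - r i) + δ * ∑ i, (r i + 1) ≤ (1 + δ) * Fintype.card ι := by
    rw [Finset.mul_sum, ← Finset.sum_add_distrib]
    refine (Finset.sum_le_card_nsmul _ _ (1 + δ) fun i _ => ?_).trans (by
      rw [nsmul_eq_mul, Finset.card_univ, mul_comm])
    nlinarith [mul_nonneg (sub_nonneg.2 hδ1) (hr i)]
  linarith

/-- A functional whose variation over the closed domain is at most `2 B` has dual local norm at
most `B`. -/
theorem abs_le_mul_relNorm {c : V →L[ℝ] ℝ} {B : ℝ}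
    (hB : ∀ y z : V, (∀ i, 0 ≤ (b + (y : EuclideanSpace ℝ ι)) i) →
      (∀ i, 0 ≤ (b + (z : EuclideanSpace ℝ ι)) i) → c y - c z ≤ 2 * B)
    {x : V} (hx : x ∈ posDomain V b) (v : V) : |c v| ≤ B * relNorm b x v := by
  rcases (relNorm_nonneg (b := b) x v).eq_or_lt with h0 | h0
  · rw [eq_zero_of_relNorm_eq_zero hx h0.symm] at *
    rw [← h0]; simp
  set s := relNorm b x v
  -- A displacement of local norm 1 changes no coordinate by more than its own size. Both ends of
  -- this diameter are therefore admissible, which explains the factor 2 in `hB`.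
  have hmem : ∀ t : ℝ, |t| = s⁻¹ → ∀ i, 0 ≤ (b + ((x + t • v : V) : EuclideanSpace ℝ ι)) i := by
    intro t ht i
    have h1 := abs_coord_le hx v i
    have h2 : |t * (v : EuclideanSpace ℝ ι) i| ≤ (b + (x : EuclideanSpace ℝ ι)) i := by
      rw [abs_mul, ht, inv_mul_le_iff₀ h0]; exact h1
    have h3 : (b + ((x + t • v : V) : EuclideanSpace ℝ ι)) i =
        (b + (x : EuclideanSpace ℝ ι)) i + t * (v : EuclideanSpace ℝ ι) i := by
      simp [add_assoc]
    rw [h3]; linarith [(abs_le.1 h2).1]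
  have key : ∀ t : ℝ, |t| = s⁻¹ → t * c v ≤ B := by
    intro t ht
    have := hB (x + t • v) (x + (-t) • v) (hmem t ht) (hmem (-t) (by rwa [abs_neg]))
    simp only [map_add, map_smul, smul_eq_mul] at this
    linarith
  have hs : |s⁻¹| = s⁻¹ := abs_of_pos (inv_pos.2 h0)
  have k1 := key s⁻¹ hs
  have k2 := key (-s⁻¹) (by rwa [abs_neg])
  rw [inv_mul_le_iff₀ h0] at k1
  rw [neg_mul, ← mul_neg, inv_mul_le_iff₀ h0] at k2
  rw [mul_comm B]
  exact abs_le.2 ⟨by linarith, k1⟩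

/-- Each `|v i| / b i` is at most the local norm of `v` at `x` times the ratio of the coordinates of
`b + x` and `b`. The initial gradient is thus controlled at every later iterate. -/
theorem abs_gradForm_zero_le {G : ℝ} (hb : ∀ i, 0 < b i) {x : V} (hx : x ∈ posDomain V b)
    (hG : ∑ i, (b + (x : EuclideanSpace ℝ ι)) i / b i ≤ G) (v : V) :
    |gradForm b 0 v| ≤ G * relNorm b x v := by
  rw [gradForm_apply, abs_neg]
  refine (Finset.abs_sum_le_sum_abs _ _).trans
    (le_trans ?_ (mul_le_mul_of_nonneg_right hG (relNorm_nonneg _ _)))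
  rw [Finset.sum_mul]
  refine Finset.sum_le_sum fun i _ => ?_
  have h1 : relCoord b 0 v i = (v : EuclideanSpace ℝ ι) i / b i := by simp [relCoord]
  rw [h1, abs_div, abs_of_pos (hb i), div_mul_eq_mul_div, mul_comm]
  gcongr
  · exact (hb i).le
  · exact abs_coord_le hx v i

end LogBarrier

/-! ### The invariant of the short-step method. -/

section ShortStep

variable {ι : Type*} [Fintype ι] {V : Submodule ℝ (EuclideanSpace ℝ ι)} {b : EuclideanSpace ℝ ι}

/-- The properties of the state of the short-step method that every iteration preserves:
`M` bounds the length of the centering phase and `R` the variation of the objective. -/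
def IPMInvariant (b : EuclideanSpace ℝ ι) (c : V →L[ℝ] ℝ) (β : ℝ) (M : ℕ) (R : ℝ) (m : ℕ) :
    IPMState V → Prop
  | .centering x ν => x ∈ posDomain V b ∧ Centered b (-ν • gradForm b 0) x (1 / 9) ∧
      ν = (1 - β) ^ m ∧ m ≤ M
  -- Here `k` counts path-following steps and the extra 1 is the switch. The case `c = 0` is
  -- separate because `η` is then 0 and cannot grow.
  | .following x η => x ∈ posDomain V b ∧ Centered b (η • c) x (1 / 9) ∧ 0 ≤ η ∧
      ∃ k, m ≤ M + 1 + k ∧ (c = 0 ∨ (1 + β) ^ k ≤ 6 * R * η)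

theorem Centered.newtonStep_of_le_quarter {l : V →L[ℝ] ℝ} {x : V} (h : Centered b l x (1 / 4))
    (hx : x ∈ posDomain V b) :
    x + TOT.newtonStep (fun y => l y + logBarrier V b y) x ∈ posDomain V b ∧
      Centered b l (x + TOT.newtonStep (fun y => l y + logBarrier V b y) x) (1 / 9) := by
  have := h.newtonStep hx (by norm_num) (by norm_num)
  exact ⟨this.1, this.2.mono (by norm_num)⟩

/-- Rescaling the functional moves the dual local norm of the gradient in a controlled way. -/
theorem Centered.smul_smul {l : V →L[ℝ] ℝ} {x : V} {δ r B : ℝ} (h : Centered b l x δ)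
    (hB : ∀ v, |gradForm b x v| ≤ B * relNorm b x v) :
    Centered b (r • l) x (|r| * δ + |1 - r| * B) := by
  intro v
  have h1 : (r • l) v + gradForm b x v = r * (l v + gradForm b x v) + (1 - r) * gradForm b x v := by
    rw [smul_apply, smul_eq_mul]; ring
  rw [h1]
  refine (abs_add_le _ _).trans ?_
  rw [abs_mul, abs_mul, add_mul, mul_assoc, mul_assoc]
  exact add_le_add (mul_le_mul_of_nonneg_left (h v) (abs_nonneg _))
    (mul_le_mul_of_nonneg_left (hB v) (abs_nonneg _))

/-- Before each Newton step the residual is at most 1/4: in centering and following it is at most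
`(1 + β) / 9 + β√θ ≤ 1/8 + 1/8`, and at the switch at most `1/6 + 1/12`. Squaring gives `1/16 ≤
1/9`. -/
theorem IPMInvariant.step {c : V →L[ℝ] ℝ} {θ : ℝ≥0} {G R : ℝ} {M m : ℕ}
    (hb : ∀ i, 0 < b i) (hθ : complexityValue (logBarrier V b) (posDomain V b) ≤ θ)
    (hθ1 : (1 : ℝ) ≤ θ)
    (hG : ∀ x ∈ posDomain V b, ∀ v, |gradForm b 0 v| ≤ G * relNorm b x v)
    (hR : ∀ x ∈ posDomain V b, ∀ v, |c v| ≤ R / 2 * relNorm b x v) (hR0 : 0 ≤ R)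
    (hM : (1 - 1 / (8 * Real.sqrt θ)) ^ M * G ≤ 1 / 18) {s : IPMState V}
    (hs : IPMInvariant b c (1 / (8 * Real.sqrt θ)) M R m s) :
    IPMInvariant b c (1 / (8 * Real.sqrt θ)) M R (m + 1)
      (ipmStep (logBarrier V b) c 0 θ s) := by
  have hsq : 1 ≤ Real.sqrt θ := Real.one_le_sqrt.2 hθ1
  set β := 1 / (8 * Real.sqrt θ) with hβ
  have hβ0 : 0 < β := by positivity
  have hβs : β * Real.sqrt θ = 1 / 8 := by rw [hβ]; field_simp
  have hβ1 : β ≤ 1 / 8 := by nlinarith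
  have h0 : (0 : V) ∈ posDomain V b := fun i => by simpa using hb i
  have hgrad := fun {x : V} (hx : x ∈ posDomain V b) => abs_gradForm_le hθ hx
  cases s with
  | centering x ν =>
    obtain ⟨hx, hc, hν, hm⟩ := hs
    simp only [ipmStep]
    split_ifs with htest
    · rw [localNorm_logBarrier hx] at htest
      have hrep : hessForm b x (localRep (logBarrier V b) x c) = c := by
        simpa using hessForm_localRep hx 0 c
      have hnewt : Centered b (0 : V →L[ℝ] ℝ) x (1 / 6) :=
        centered_of_relNorm_newtonStep_le hx (by simpa using htest)
      rw [localNorm_logBarrier hx]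
      set S := relNorm b x (localRep (logBarrier V b) x c) with hS
      have hS0 : 0 ≤ S := relNorm_nonneg _ _
      have hSR : S ≤ R / 2 := relNorm_le_of_hessForm_eq hrep (by linarith) (hR x hx)
      have hη0 : 0 ≤ 1 / (12 * S) := by positivity
      -- If `S = 0`, the convention `1 / 0 = 0` gives `η = 0`, as prescribed for a vanishing cost.
      have hηS : 1 / (12 * S) * S ≤ 1 / 12 := by
        rcases hS0.eq_or_lt with h | h
        · rw [← h]; norm_num
        · exact le_of_eq (by field_simp)
      have hquarter : Centered b ((1 / (12 * S)) • c) x (1 / 4) := by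
        intro v
        have h1 := hnewt v
        simp only [zero_apply, zero_add] at h1
        have h2 := abs_hessForm_le (b := b) x (localRep (logBarrier V b) x c) v
        rw [hrep] at h2
        have h3 : |(1 / (12 * S)) * c v| ≤ 1 / 12 * relNorm b x v := by
          rw [abs_mul, abs_of_nonneg hη0]
          calc _ ≤ 1 / (12 * S) * (S * relNorm b x v) := mul_le_mul_of_nonneg_left h2 hη0
            _ = (1 / (12 * S) * S) * relNorm b x v := by ring
            _ ≤ _ := mul_le_mul_of_nonneg_right hηS (relNorm_nonneg _ _)
        rw [smul_apply, smul_eq_mul]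
        refine (abs_add_le _ _).trans ((add_le_add h3 h1).trans (le_of_eq (by ring)))
      obtain ⟨hx', hc'⟩ := hquarter.newtonStep_of_le_quarter hx
      refine ⟨hx', hc', hη0, 0, by omega, ?_⟩
      by_cases hc0 : c = 0
      · exact Or.inl hc0
      · right
        have hSpos : 0 < S := by
          refine hS0.lt_of_ne fun h => hc0 ?_
          rw [← hrep, eq_zero_of_relNorm_eq_zero hx h.symm, map_zero]
        rw [pow_zero, mul_one_div, le_div_iff₀ (by positivity)]
        linarith
    -- After `M` centering steps the switching test must succeed: dropping the term in `ν` changes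
    -- the residual by at most 1/18, and `1/9 + 1/18 = 1/6`.
    · have hmM : m < M := by
        by_contra hmM
        have hmM : m = M := by omega
        refine htest ?_
        rw [localNorm_logBarrier hx]
        have hν0 : 0 ≤ ν := by rw [hν]; exact pow_nonneg (by linarith) _
        have hc6 : Centered b (0 : V →L[ℝ] ℝ) x (1 / 6) := by
          intro v
          have h1 := hc v
          have h2 : |ν * gradForm b 0 v| ≤ 1 / 18 * relNorm b x v := by
            rw [abs_mul, abs_of_nonneg hν0]
            calc _ ≤ ν * (G * relNorm b x v) := mul_le_mul_of_nonneg_left (hG x hx v) hν0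
              _ = (ν * G) * relNorm b x v := by ring
              _ ≤ _ := by
                refine mul_le_mul_of_nonneg_right ?_ (relNorm_nonneg _ _)
                rw [hν, hmM]; exact hM
          have h3 : (0 : V →L[ℝ] ℝ) v + gradForm b x v =
              ((-ν • gradForm b 0) v + gradForm b x v) + ν * gradForm b 0 v := by
            simp only [smul_apply, zero_apply, smul_eq_mul]; ring
          rw [h3]
          exact (abs_add_le _ _).trans ((add_le_add h1 h2).trans (le_of_eq (by ring)))
        simpa using hc6.relNorm_newtonStep_le hx (by norm_num)
      have hquarter : Centered b (-((1 - β) * ν) • gradForm b 0) x (1 / 4) := by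
        have h1 := hc.smul_smul (r := 1 - β) (hgrad hx)
        have h2 : (1 - β) • (-ν • gradForm b (0 : V)) = -((1 - β) * ν) • gradForm b 0 := by
          rw [smul_smul]; congr 1; ring
        rw [h2, abs_of_nonneg (by linarith), sub_sub_cancel, abs_of_pos hβ0, hβs] at h1
        exact h1.mono (by linarith)
      have hfun : (fun y => logBarrier V b y - (1 - β) * ν * fderiv ℝ (logBarrier V b) 0 y) =
          fun y => (-((1 - β) * ν) • gradForm b (0 : V)) y + logBarrier V b y := by
        funext y
        rw [(hasFDerivAt_logBarrier h0).fderiv, smul_apply, smul_eq_mul]; ring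
      rw [hfun]
      obtain ⟨hx', hc'⟩ := hquarter.newtonStep_of_le_quarter hx
      exact ⟨hx', hc', by rw [hν, pow_succ'], hmM⟩
  | following x η =>
    obtain ⟨hx, hc, hη0, k, hk, hgrow⟩ := hs
    simp only [ipmStep]
    have hquarter : Centered b (((1 + β) * η) • c) x (1 / 4) := by
      have h1 := hc.smul_smul (r := 1 + β) (hgrad hx)
      rw [smul_smul, abs_of_nonneg (by linarith : 0 ≤ 1 + β),
        (by ring : 1 - (1 + β) = -β), abs_neg, abs_of_pos hβ0, hβs] at h1
      exact h1.mono (by linarith)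
    obtain ⟨hx', hc'⟩ := hquarter.newtonStep_of_le_quarter hx
    refine ⟨hx', hc', by positivity, k + 1, by omega, hgrow.imp id fun h => ?_⟩
    rw [pow_succ']
    calc (1 + β) * (1 + β) ^ k ≤ (1 + β) * (6 * R * η) :=
          mul_le_mul_of_nonneg_left h (by linarith)
      _ = _ := by ring

theorem ipmInvariant_iterate {c : V →L[ℝ] ℝ} {θ : ℝ≥0} {G R : ℝ} {M : ℕ}
    (hb : ∀ i, 0 < b i) (hθ : complexityValue (logBarrier V b) (posDomain V b) ≤ θ)
    (hθ1 : (1 : ℝ) ≤ θ)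
    (hG : ∀ x ∈ posDomain V b, ∀ v, |gradForm b 0 v| ≤ G * relNorm b x v)
    (hR : ∀ x ∈ posDomain V b, ∀ v, |c v| ≤ R / 2 * relNorm b x v) (hR0 : 0 ≤ R)
    (hM : (1 - 1 / (8 * Real.sqrt θ)) ^ M * G ≤ 1 / 18) (m : ℕ) :
    IPMInvariant b c (1 / (8 * Real.sqrt θ)) M R m
      ((ipmStep (logBarrier V b) c 0 θ)^[m] (.centering 0 1)) := by
  induction m with
  | zero =>
    refine ⟨fun i => by simpa using hb i, fun v => ?_, by simp, Nat.zero_le _⟩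
    have h : (-(1 : ℝ) • gradForm b (0 : V)) v + gradForm b 0 v = 0 := by simp
    rw [h, abs_zero]
    exact mul_nonneg (by norm_num) (relNorm_nonneg _ _)
  | succ m ih =>
    rw [Function.iterate_succ_apply']
    exact ih.step hb hθ hθ1 hG hR hR0 hM

theorem IPMInvariant.point_mem {c : V →L[ℝ] ℝ} {β R : ℝ} {M m : ℕ} {s : IPMState V}
    (hs : IPMInvariant b c β M R m s) : s.point ∈ posDomain V b := by
  cases s <;> exact hs.1

/-- After more than `M` iterations centering is over, and at least `m` path-following steps have
made `6 * R * η` at least `(1 + β) ^ m`. The constant 7 rounds up `6 * (10/9)`. -/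
theorem IPMInvariant.gap {c : V →L[ℝ] ℝ} {β R : ℝ} {M m : ℕ} {s : IPMState V} (hβ : 0 ≤ β)
    (hs : IPMInvariant b c β M R (M + 1 + m) s) (hR0 : 0 ≤ R) {y : V}
    (hy : ∀ i, 0 ≤ (b + (y : EuclideanSpace ℝ ι)) i) :
    (1 + β) ^ m * (c s.point - c y) ≤ 7 * Fintype.card ι * R := by
  cases s with
  | centering x ν => exact absurd hs.2.2.2 (by omega)
  | following x η =>
    obtain ⟨hx, hc, hη0, k, hk, hgrow⟩ := hs
    have hN : (0 : ℝ) ≤ 7 * Fintype.card ι * R := by positivity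
    rcases hgrow with rfl | hgrow
    · simpa using hN
    rcases le_total (c x - c y) 0 with hneg | hpos
    · exact (mul_nonpos_of_nonneg_of_nonpos (by positivity) hneg).trans hN
    have h1 := hc.mul_sub_le hx (by norm_num) (by norm_num) hy
    calc (1 + β) ^ m * (c x - c y) ≤ (6 * R * η) * (c x - c y) := by
          refine mul_le_mul_of_nonneg_right (le_trans ?_ hgrow) hpos
          exact pow_le_pow_right₀ (by linarith) (by omega)
      _ = 6 * R * (η * (c x - c y)) := by ring
      _ ≤ 6 * R * ((1 + 1 / 9) * Fintype.card ι) :=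
          mul_le_mul_of_nonneg_left h1 (by positivity)
      _ ≤ _ := by nlinarith [mul_nonneg hR0 (Nat.cast_nonneg (α := ℝ) (Fintype.card ι))]

end ShortStep

/-! ### Lengths of the two phases. -/

section Counting

theorem one_sub_pow_mul_le {β G : ℝ} {M : ℕ} (hβ1 : β ≤ 1) (hG : 0 < G)
    (hM : Real.log (18 * G) ≤ β * M) : (1 - β) ^ M * G ≤ 1 / 18 := by
  have h1 : (1 - β) ^ M ≤ Real.exp (-(β * M)) := by
    have h := Real.one_sub_le_exp_neg β
    calc (1 - β) ^ M ≤ Real.exp (-β) ^ M := pow_le_pow_left₀ (by linarith) h _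
      _ = _ := by rw [← Real.exp_nat_mul]; congr 1; ring
  have h2 : Real.exp (-(β * M)) ≤ (18 * G)⁻¹ := by
    rw [← Real.exp_log (show 0 < (18 * G)⁻¹ by positivity), Real.log_inv]
    exact Real.exp_le_exp.2 (by linarith)
  calc (1 - β) ^ M * G ≤ (18 * G)⁻¹ * G := mul_le_mul_of_nonneg_right (h1.trans h2) hG.le
    _ = 1 / 18 := by field_simp

theorem le_one_add_pow {β A : ℝ} {k : ℕ} (hβ0 : 0 ≤ β) (hβ1 : β ≤ 1) (hA : 0 < A)
    (hk : Real.log A ≤ β / 2 * k) : A ≤ (1 + β) ^ k := by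
  -- From `1 - β / 2 ≤ exp (-β / 2)` and `(1 + β) * (1 - β / 2) ≥ 1`, valid for `0 ≤ β ≤ 1`.
  have h1 : Real.exp (β / 2) ≤ 1 + β := by
    have h := Real.one_sub_le_exp_neg (β / 2)
    rw [Real.exp_neg] at h
    have h2 : Real.exp (β / 2) ≤ (1 - β / 2)⁻¹ := by
      rw [← inv_inv (Real.exp (β / 2))]
      exact inv_anti₀ (by linarith) h
    refine h2.trans ?_
    rw [inv_le_iff_one_le_mul₀ (by linarith)]
    nlinarith
  calc A = Real.exp (Real.log A) := (Real.exp_log hA).symm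
    _ ≤ Real.exp (k * (β / 2)) := Real.exp_le_exp.2 (by linarith)
    _ = Real.exp (β / 2) ^ k := Real.exp_nat_mul _ _
    _ ≤ _ := pow_le_pow_left₀ (Real.exp_pos _).le h1 _

/-- Splitting an iteration budget into a centering and a path-following phase. -/
theorem exists_phase_lengths {θ N a ε : ℝ} (hθ1 : 1 ≤ θ) (hθN : θ ≤ N) (hN : 4 ≤ N)
    (ha : 0 < a) (ha1 : a ≤ 1) (hε : 0 < ε) (hε1 : ε ≤ 1) {m : ℕ}
    (hm : 80 * (Real.sqrt N * Real.log (Real.sqrt 2 * N / (ε * a))) ≤ m) :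
    ∃ M k : ℕ, m = M + 1 + k ∧ (1 - 1 / (8 * Real.sqrt θ)) ^ M * (N / a) ≤ 1 / 18 ∧
      7 * N / ε ≤ (1 + 1 / (8 * Real.sqrt θ)) ^ k := by
  have hs2 : Real.sqrt 2 ^ 2 = 2 := Real.sq_sqrt (by norm_num)
  have hs0 : 0 < Real.sqrt 2 := by positivity
  have hs1 : 7 / 5 ≤ Real.sqrt 2 := Real.le_sqrt_of_sq_le (by norm_num)
  set L := Real.log (Real.sqrt 2 * N / (ε * a)) with hL
  have hea : ε * a ≤ 1 := mul_le_one₀ hε1 ha.le ha1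
  have hX : 0 < Real.sqrt 2 * N / (ε * a) := by positivity
  have hXge : Real.sqrt 2 * N ≤ Real.sqrt 2 * N / (ε * a) :=
    le_div_self (by positivity) (by positivity) hea
  have hL1 : 1 ≤ L := by
    rw [hL, Real.le_log_iff_exp_le hX]
    have := Real.exp_one_lt_d9
    nlinarith
  have hXε : Real.sqrt 2 * N / ε ≤ Real.sqrt 2 * N / (ε * a) :=
    div_le_div_of_nonneg_left (by positivity) (by positivity) (mul_le_of_le_one_right hε.le ha1)
  have hXa : Real.sqrt 2 * N / a ≤ Real.sqrt 2 * N / (ε * a) :=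
    div_le_div_of_nonneg_left (by positivity) (by positivity) (mul_le_of_le_one_left ha.le hε1)
  -- The condition `4 ≤ N` absorbs the constants into powers of the argument of `L`: here `18 ≤ 2 *
  -- N ^ 2`, and in `hlog2` `7 ≤ 2 * N`.
  have hlog1 : Real.log (18 * (N / a)) ≤ 3 * L := by
    have h1 : 3 * L = Real.log ((Real.sqrt 2 * N / (ε * a)) ^ 3) := by rw [Real.log_pow, hL]; norm_num
    rw [h1]
    refine Real.log_le_log (by positivity) ?_
    calc 18 * (N / a) ≤ (Real.sqrt 2 * N) ^ 2 * (Real.sqrt 2 * N / a) := by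
          rw [mul_pow, hs2, mul_div_assoc, ← mul_assoc]
          refine mul_le_mul_of_nonneg_right ?_ (by positivity)
          nlinarith
      _ ≤ (Real.sqrt 2 * N / (ε * a)) ^ 2 * (Real.sqrt 2 * N / (ε * a)) := by gcongr
      _ = _ := by ring
  have hlog2 : Real.log (7 * N / ε) ≤ 2 * L := by
    have h1 : 2 * L = Real.log ((Real.sqrt 2 * N / (ε * a)) ^ 2) := by rw [Real.log_pow, hL]; norm_num
    rw [h1]
    refine Real.log_le_log (by positivity) ?_
    calc 7 * N / ε ≤ (Real.sqrt 2 * N) * (Real.sqrt 2 * N / ε) := by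
          rw [← mul_div_assoc]
          refine div_le_div_of_nonneg_right ?_ hε.le
          have : Real.sqrt 2 * N * (Real.sqrt 2 * N) = 2 * N * N := by linear_combination N ^ 2 * hs2
          nlinarith
      _ ≤ (Real.sqrt 2 * N / (ε * a)) * (Real.sqrt 2 * N / (ε * a)) := by gcongr
      _ = _ := by ring
  have hsθ : 1 ≤ Real.sqrt θ := Real.one_le_sqrt.2 hθ1
  have hsθN : Real.sqrt θ ≤ Real.sqrt N := Real.sqrt_le_sqrt hθN
  have hβ1 : 1 / (8 * Real.sqrt θ) ≤ 1 := by
    rw [div_le_one (by positivity)]; linarith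
  have hfloor := Nat.lt_floor_add_one (24 * (Real.sqrt N * L))
  have hceil := Nat.ceil_lt_add_one (show 0 ≤ 24 * (Real.sqrt N * L) by positivity)
  have hle := Nat.le_ceil (24 * (Real.sqrt N * L))
  -- Centering needs `3L / β = 24√θ L` steps and following needs `4L / β = 32√θ L`. Rounding and the
  -- switch cost at most 2 more, and `√N L ≥ 1`, so 80 suffices.
  set M := ⌈24 * (Real.sqrt N * L)⌉₊
  have hSL : 1 ≤ Real.sqrt N * L := one_le_mul_of_one_le_of_one_le (hsθ.trans hsθN) hL1
  have hmM : M + 1 ≤ m := by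
    have : ((M + 1 : ℕ) : ℝ) ≤ m := by push_cast; linarith
    exact_mod_cast this
  obtain ⟨k, hk⟩ := Nat.exists_eq_add_of_le hmM
  refine ⟨M, k, hk, one_sub_pow_mul_le hβ1 (by positivity) (hlog1.trans ?_),
    le_one_add_pow (by positivity) hβ1 (by positivity) (hlog2.trans ?_)⟩
  · rw [div_mul_eq_mul_div, one_mul, le_div_iff₀ (by positivity)]
    have : L * Real.sqrt θ ≤ Real.sqrt N * L := by nlinarith
    linarith
  · have hk' : (m : ℝ) = M + 1 + k := by exact_mod_cast hk
    have : L * Real.sqrt θ ≤ Real.sqrt N * L := by nlinarith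
    rw [div_div, div_mul_eq_mul_div, one_mul, le_div_iff₀ (by positivity)]
    linarith

end Counting

/-! ### The polytope, its compactness and the size of its entries. -/

section Polytope

variable {d : ℕ} {n : Fin d → ℕ}

theorem modeSum_sub (k : Fin d) (U W : Tensor n) (i : (j : Fin d) → Fin (n j)) :
    modeSum k (U - W) i = modeSum k U i - modeSum k W i := by
  simp [modeSum, Finset.sum_sub_distrib]

theorem le_modeSum {U : Tensor n} (hU : ∀ i, 0 ≤ U i) (k : Fin d)
    (i : (j : Fin d) → Fin (n j)) : U i ≤ modeSum k U i := by
  have := Finset.single_le_sum (f := fun a => U (Function.update i k a)) (fun a _ => hU _)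
    (Finset.mem_univ (i k))
  simpa [modeSum, Function.update_eq_self] using this

theorem modeSum_prodTensor {p : (k : Fin d) → Fin (n k) → ℝ} (hp : ∀ k, ∑ j, p k j = 1)
    (k : Fin d) (i : (j : Fin d) → Fin (n j)) :
    modeSum k (prodTensor p) i = ∏ j ∈ Finset.univ.erase k, p j (i j) := by
  have h : ∀ a, prodTensor p (Function.update i k a) =
      p k a * ∏ j ∈ Finset.univ.erase k, p j (i j) := by
    intro a
    rw [prodTensor]
    change ∏ j, p j (Function.update i k a j) = _
    rw [← Finset.mul_prod_erase _ _ (Finset.mem_univ k), Function.update_self]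
    congr 1
    refine Finset.prod_congr rfl fun j hj => ?_
    rw [Function.update_of_ne (Finset.ne_of_mem_erase hj)]
  simp only [modeSum, h]
  rw [← Finset.sum_mul, hp, one_mul]

theorem mem_polytopeV_iff {p : (k : Fin d) → Fin (n k) → ℝ} (hp : ∀ k, ∑ j, p k j = 1)
    (U : Tensor n) :
    U ∈ polytopeV p ↔ (∀ i, 0 ≤ U i) ∧ U - prodTensor p ∈ spaceV0 n := by
  refine and_congr_right fun _ => forall_congr' fun k => forall_congr' fun i => ?_
  rw [modeSum_sub, modeSum_prodTensor hp, sub_eq_zero]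

theorem add_mem_polytopeV {p : (k : Fin d) → Fin (n k) → ℝ} (hp : ∀ k, ∑ j, p k j = 1)
    (W : spaceV0 n) (hW : ∀ i, 0 ≤ (prodTensor p + (W : Tensor n)) i) :
    prodTensor p + (W : Tensor n) ∈ polytopeV p := by
  rw [mem_polytopeV_iff hp, add_sub_cancel_left]
  exact ⟨hW, W.2⟩

theorem prodTensor_pos {p : (k : Fin d) → Fin (n k) → ℝ} (hpos : ∀ k j, 0 < p k j)
    (i : (j : Fin d) → Fin (n j)) : 0 < prodTensor p i := by
  change 0 < ∏ k, p k (i k)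
  exact Finset.prod_pos fun k _ => hpos k (i k)

theorem le_one_of_sum_eq_one {p : (k : Fin d) → Fin (n k) → ℝ} (hpos : ∀ k j, 0 < p k j)
    (hp : ∀ k, ∑ j, p k j = 1) (k : Fin d) (j : Fin (n k)) : p k j ≤ 1 := by
  rw [← hp k]
  exact Finset.single_le_sum (f := p k) (fun a _ => (hpos k a).le) (Finset.mem_univ j)

theorem le_one_of_mem_polytopeV {p : (k : Fin d) → Fin (n k) → ℝ} (hpos : ∀ k j, 0 < p k j)
    (hp : ∀ k, ∑ j, p k j = 1) (k : Fin d) {U : Tensor n} (hU : U ∈ polytopeV p)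
    (i : (j : Fin d) → Fin (n j)) : U i ≤ 1 := by
  refine (le_modeSum hU.1 k i).trans ?_
  rw [hU.2 k i]
  exact Finset.prod_le_one (fun j _ => (hpos j _).le) fun j _ => le_one_of_sum_eq_one hpos hp j _

theorem isCompact_polytopeV {p : (k : Fin d) → Fin (n k) → ℝ} (hpos : ∀ k j, 0 < p k j)
    (hp : ∀ k, ∑ j, p k j = 1) (k : Fin d) : IsCompact (polytopeV p) := by
  have hcoord : ∀ i, Continuous fun U : Tensor n => U i := fun i =>
    (EuclideanSpace.proj i : Tensor n →L[ℝ] ℝ).continuous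
  refine Metric.isCompact_of_isClosed_isBounded ?_ ?_
  · have : polytopeV p = (⋂ i, {U : Tensor n | 0 ≤ U i}) ∩
        ⋂ k, ⋂ i, {U : Tensor n | modeSum k U i = ∏ j ∈ Finset.univ.erase k, p j (i j)} := by
      ext U; simp [polytopeV]
    rw [this]
    refine (isClosed_iInter fun i => isClosed_le continuous_const (hcoord i)).inter
      (isClosed_iInter fun k => isClosed_iInter fun i => isClosed_eq ?_ continuous_const)
    exact continuous_finsetSum _ fun a _ => hcoord _
  · refine isBounded_iff_forall_norm_le.2
      ⟨Real.sqrt (Fintype.card ((k : Fin d) → Fin (n k))), fun U hU => ?_⟩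
    rw [EuclideanSpace.norm_eq]
    refine Real.sqrt_le_sqrt ((Finset.sum_le_card_nsmul _ _ 1 fun i _ => ?_).trans (by simp))
    rw [Real.norm_eq_abs, abs_of_nonneg (hU.1 i)]
    exact pow_le_one₀ (hU.1 i) (le_one_of_mem_polytopeV hpos hp k hU i)

theorem prodTensor_mem_polytopeV {p : (k : Fin d) → Fin (n k) → ℝ} (hpos : ∀ k j, 0 < p k j)
    (hp : ∀ k, ∑ j, p k j = 1) : prodTensor p ∈ polytopeV p :=
  ⟨fun i => (prodTensor_pos hpos i).le, modeSum_prodTensor hp⟩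

theorem isCompact_costValues {p : (k : Fin d) → Fin (n k) → ℝ} (hpos : ∀ k j, 0 < p k j)
    (hp : ∀ k, ∑ j, p k j = 1) (k : Fin d) (C : Tensor n) : IsCompact (costValues C p) :=
  (isCompact_polytopeV hpos hp k).image (innerSL ℝ C).continuous

theorem inner_prodTensor_add (C : Tensor n) (p : (k : Fin d) → Fin (n k) → ℝ) (W : spaceV0 n) :
    inner ℝ C (prodTensor p + (W : Tensor n)) = inner ℝ C (prodTensor p) + costV C W := by
  rw [inner_add_right]; rfl

/-- A nonnegative tensor with a vanishing marginal is zero. This supplies the line to the boundary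
used for `1 ≤ θ`. -/
theorem exists_neg_of_ne_zero (k : Fin d) {W : spaceV0 n} (hW : W ≠ 0) :
    ∃ i, (W : Tensor n) i < 0 := by
  by_contra! h
  refine hW (Subtype.ext ?_)
  ext i
  exact le_antisymm ((le_modeSum h k i).trans (W.2 k i).le) (h i)

/-- Along a mode of size at most 1 the marginal is the tensor itself, so `V₀` would be trivial. -/
theorem two_le_of_ne_zero {W : spaceV0 n} (hW : W ≠ 0) (k : Fin d) : 2 ≤ n k := by
  by_contra! h
  refine hW (Subtype.ext ?_)
  ext i
  have hsub : Subsingleton (Fin (n k)) := by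
    rw [← Fintype.card_le_one_iff_subsingleton, Fintype.card_fin]; omega
  have h1 := W.2 k i
  rw [modeSum, Fintype.sum_subsingleton _ (i k), Function.update_eq_self] at h1
  exact h1

theorem four_le_prod (hd : 2 ≤ d) (hn : ∀ k, 2 ≤ n k) : 4 ≤ ∏ k, n k := by
  calc 4 = 2 ^ 2 := by norm_num
    _ ≤ 2 ^ d := Nat.pow_le_pow_right (by norm_num) hd
    _ = ∏ _k : Fin d, 2 := by simp
    _ ≤ _ := Finset.prod_le_prod' fun k _ => hn k

theorem iInf_pos_of_sum_eq_one {p : (k : Fin d) → Fin (n k) → ℝ} (hpos : ∀ k j, 0 < p k j)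
    (hp : ∀ k, ∑ j, p k j = 1) (k : Fin d) : 0 < ⨅ j, p k j ∧ ⨅ j, p k j ≤ 1 := by
  have hne : Nonempty (Fin (n k)) := by
    by_contra h
    rw [not_nonempty_iff] at h
    simpa using hp k
  obtain ⟨j, hj⟩ := exists_eq_ciInf_of_finite (f := p k)
  rw [← hj]
  exact ⟨hpos k j, le_one_of_sum_eq_one hpos hp k j⟩

theorem prod_iInf_le_prodTensor {p : (k : Fin d) → Fin (n k) → ℝ} (hpos : ∀ k j, 0 < p k j)
    (hp : ∀ k, ∑ j, p k j = 1) (i : (j : Fin d) → Fin (n j)) :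
    ∏ k, ⨅ j, p k j ≤ prodTensor p i :=
  Finset.prod_le_prod (fun k _ => (iInf_pos_of_sum_eq_one hpos hp k).1.le) fun k _ =>
    ciInf_le (Finite.bddBelow_range _) (i k)

/-- Entries of the polytope are at most 1 and those of the product tensor at least the product of
the minima. This is how the `p k` enter the iteration count. -/
theorem sum_div_prodTensor_le {p : (k : Fin d) → Fin (n k) → ℝ} (hpos : ∀ k j, 0 < p k j)
    (hp : ∀ k, ∑ j, p k j = 1) (k : Fin d) {U : Tensor n} (hU : U ∈ polytopeV p) :
    ∑ i, U i / prodTensor p i ≤ (∏ k, (n k : ℝ)) / ∏ k, ⨅ j, p k j := by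
  have ha : 0 < ∏ k, ⨅ j, p k j :=
    Finset.prod_pos fun k _ => (iInf_pos_of_sum_eq_one hpos hp k).1
  refine (Finset.sum_le_card_nsmul _ _ (1 / ∏ k, ⨅ j, p k j) fun i _ => ?_).trans ?_
  · exact div_le_div₀ zero_le_one (le_one_of_mem_polytopeV hpos hp k hU i) ha
      (prod_iInf_le_prodTensor hpos hp i)
  · rw [nsmul_eq_mul, mul_one_div, Finset.card_univ, Fintype.card_pi]
    simp

end Polytope

end TOT

end

/-! ### Assembly of the theorem. -/

open TOT

theorem theorem2p6 :
    ∃ K : ℝ, 0 < K ∧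
      ∀ (d : ℕ) (_ : 2 ≤ d) (n : Fin d → ℕ) (p : (k : Fin d) → Fin (n k) → ℝ)
        (_ : ∀ k j, 0 < p k j) (_ : ∀ k, ∑ j, p k j = 1) (C : TOT.Tensor n),
        IsLeast (TOT.costValues C p) (TOT.tau C p) ∧
        IsGreatest (TOT.costValues C p) (TOT.tauMax C p) ∧
        TOT.complexityValue (TOT.sigmaTilde p) (TOT.domainV p) ≤ ((∏ k, n k : ℕ) : ℝ≥0∞) ∧
        ∀ θ : ℝ≥0,
          TOT.complexityValue (TOT.sigmaTilde p) (TOT.domainV p) ≤ (θ : ℝ≥0∞) →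
          θ ≤ ((∏ k, n k : ℕ) : ℝ≥0) →
          (∀ m : ℕ, TOT.ipmTensor C p (θ : ℝ) m ∈ TOT.interiorV p) ∧
          ∀ ε : ℝ, 0 < ε → ∀ m : ℕ,
            K * (Real.sqrt (∏ k, (n k : ℝ)) *
              Real.log (Real.sqrt 2 * (∏ k, (n k : ℝ)) / (ε * ∏ k, ⨅ j, p k j))) ≤ (m : ℝ) →
            inner ℝ C (TOT.ipmTensor C p (θ : ℝ) m) - TOT.tau C p
              ≤ ε * (TOT.tauMax C p - TOT.tau C p) := by
  refine ⟨80, by norm_num, fun d hd n p hpos hp C => ?_⟩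
  have k₀ : Fin d := ⟨0, by omega⟩
  have hne : (costValues C p).Nonempty := ⟨_, _, prodTensor_mem_polytopeV hpos hp, rfl⟩
  have hcpt := isCompact_costValues hpos hp k₀ C
  have hleast : IsLeast (costValues C p) (tau C p) := hcpt.isLeast_sInf hne
  have hgreat : IsGreatest (costValues C p) (tauMax C p) := hcpt.isGreatest_sSup hne
  have hcard : Fintype.card ((k : Fin d) → Fin (n k)) = ∏ k, n k := by
    rw [Fintype.card_pi]; simp
  refine ⟨hleast, hgreat, ?_, fun θ hθ hθN => ?_⟩
  · rw [← hcard]; exact complexityValue_logBarrier_le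
  change complexityValue (logBarrier (spaceV0 n) (prodTensor p))
    (posDomain (spaceV0 n) (prodTensor p)) ≤ θ at hθ
  set b := prodTensor p with hbdef
  have hb : ∀ i, 0 < b i := prodTensor_pos hpos
  have hinner : ∀ {U}, U ∈ polytopeV p → inner ℝ C U - tau C p ≤ tauMax C p - tau C p :=
    fun hU => sub_le_sub_right (hgreat.2 ⟨_, hU, rfl⟩) _
  have hR0 : 0 ≤ tauMax C p - tau C p := sub_nonneg.2 (hgreat.2 hleast.1)
  have hinterior : ∀ W : spaceV0 n, W ∈ posDomain (spaceV0 n) b →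
      b + (W : Tensor n) ∈ interiorV p := fun W hW =>
    ⟨add_mem_polytopeV hp W fun i => (hW i).le, hW⟩
  obtain ⟨U₀, hU₀, hτ⟩ := hleast.1
  simp only at hτ
  obtain ⟨W₀, hW₀⟩ : ∃ W₀ : spaceV0 n, U₀ = b + (W₀ : Tensor n) :=
    ⟨⟨_, ((mem_polytopeV_iff hp _).1 hU₀).2⟩, by simp [hbdef]⟩
  -- If `V₀` is trivial, the bounds `1 ≤ θ` and `4 ≤ N` may fail, but the only iterate is the
  -- product tensor, which is optimal.
  by_cases htriv : ∀ W : spaceV0 n, W = 0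
  · have hX : ∀ m, ipmTensor C p θ m = b := fun m => by
      rw [ipmTensor, htriv (ipmIterate _ _ _ _ m)]; simp [hbdef]
    have hU₀b : U₀ = b := by rw [hW₀, htriv W₀]; simp
    refine ⟨fun m => ?_, fun ε hε m _ => ?_⟩
    · rw [hX]; exact ⟨prodTensor_mem_polytopeV hpos hp, hb⟩
    · rw [hX, ← hU₀b, hτ, sub_self]; exact mul_nonneg hε.le hR0
  push Not at htriv
  obtain ⟨W₁, hW₁⟩ := htriv
  have hθ1 : (1 : ℝ) ≤ θ := one_le_of_complexityValue_le hθ hb (exists_neg_of_ne_zero k₀ hW₁)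
  have hN4 : (4 : ℝ) ≤ ∏ k, (n k : ℝ) := by
    exact_mod_cast four_le_prod hd (two_le_of_ne_zero hW₁)
  have hθN' : (θ : ℝ) ≤ ∏ k, (n k : ℝ) := by exact_mod_cast hθN
  have ha : 0 < ∏ k, ⨅ j, p k j :=
    Finset.prod_pos fun k _ => (iInf_pos_of_sum_eq_one hpos hp k).1
  have ha1 : ∏ k, ⨅ j, p k j ≤ 1 := Finset.prod_le_one
    (fun k _ => (iInf_pos_of_sum_eq_one hpos hp k).1.le)
    fun k _ => (iInf_pos_of_sum_eq_one hpos hp k).2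
  have hG : ∀ x ∈ posDomain (spaceV0 n) b, ∀ v, |gradForm b 0 v| ≤
      ((∏ k, (n k : ℝ)) / ∏ k, ⨅ j, p k j) * relNorm b x v := fun x hx =>
    abs_gradForm_zero_le hb hx (sum_div_prodTensor_le hpos hp k₀ (hinterior x hx).1)
  have hR : ∀ x ∈ posDomain (spaceV0 n) b, ∀ v,
      |costV C v| ≤ (tauMax C p - tau C p) / 2 * relNorm b x v := by
    intro x hx
    refine abs_le_mul_relNorm (fun y z hy hz => ?_) hx
    have h1 := hgreat.2 ⟨_, add_mem_polytopeV hp y hy, rfl⟩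
    have h2 := hleast.2 ⟨_, add_mem_polytopeV hp z hz, rfl⟩
    simp only [inner_prodTensor_add] at h1 h2
    linarith
  have hinv := fun M hM => ipmInvariant_iterate (c := costV C) (M := M) hb hθ hθ1 hG hR hR0 hM
  have hmem : ∀ m, ipmTensor C p θ m ∈ interiorV p := by
    intro m
    -- Feasibility only needs some admissible bound `M` on the centering phase; precision 1 with a
    -- large enough budget provides one.
    obtain ⟨M, -, -, hM, -⟩ := exists_phase_lengths hθ1 hθN' hN4 ha ha1 one_pos le_rfl
      (Nat.le_ceil _)
    exact hinterior _ (hinv M hM m).point_mem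
  refine ⟨hmem, fun ε hε m hm => ?_⟩
  -- For `ε ≥ 1` any feasible point will do; the counting of phases requires `ε ≤ 1`.
  rcases le_total 1 ε with hε1 | hε1
  · exact (hinner (hmem m).1).trans (le_mul_of_one_le_left hR0 hε1)
  obtain ⟨M, k, rfl, hM, hk⟩ := exists_phase_lengths hθ1 hθN' hN4 ha ha1 hε hε1 hm
  have hgap := (hinv M hM (M + 1 + k)).gap (by positivity) hR0 (y := W₀)
    (fun i => by rw [← hW₀]; exact hU₀.1 i)
  set P := (1 + 1 / (8 * Real.sqrt θ)) ^ k
  set g := inner ℝ C (ipmTensor C p θ (M + 1 + k)) - tau C p with hg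
  have hgeq : g = costV C (ipmIterate (sigmaTilde p) (costV C) 0 θ (M + 1 + k)) - costV C W₀ := by
    rw [hg, ← hτ, hW₀, ipmTensor, hbdef, inner_prodTensor_add, inner_prodTensor_add]; ring
  have hg0 : 0 ≤ g := sub_nonneg.2 (hleast.2 ⟨_, (hmem _).1, rfl⟩)
  have hgap' : P * g ≤ 7 * (∏ k, (n k : ℝ)) * (tauMax C p - tau C p) := by
    rw [hgeq]
    rw [hcard] at hgap
    push_cast at hgap
    exact hgap
  have h7 : 7 * (∏ k, (n k : ℝ)) / ε * g ≤ 7 * (∏ k, (n k : ℝ)) * (tauMax C p - tau C p) :=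
    (mul_le_mul_of_nonneg_right hk hg0).trans hgap'
  rw [div_mul_eq_mul_div, div_le_iff₀ hε, mul_assoc, mul_comm _ ε] at h7
  have hpos7 : 0 < 7 * ∏ k, (n k : ℝ) := by linarith
  refine le_of_mul_le_mul_left ?_ hpos7
  calc _ = 7 * ((∏ k, (n k : ℝ)) * g) := by ring
    _ ≤ _ := h7
    _ = _ := by ring
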